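/- For a prime power $q$ let $\mathbb F_q$ be the field with $q$ elements and let $\mathrm{Sym}_n(q)$ be the $\mathbb F_q$-space of symmetric $n\times n$ matrices over $\mathbb F_q$. The minimum distance of a nonzero $\mathbb F_q$-subspace $\mathcal C\le \mathbb F_q^{n\times n}$ is $\min\{\mathrm{rk}(M) : M\in\mathcal C,\ M\neq 0\}$. Let $\delta_q^{\mathrm{Sym}}(n\times n,k,d)$ denote the proportion of subspaces of minimum distance at least $d$ among all $k$-dimensional $\mathbb F_q$-subspaces of $\mathrm{Sym}_n(q)$. **Theorem.** Let $n\ge 2$, $2\le d\le n$ and $k$ be integers (not depending on $q$) with $$1\le k\le \begin{cases} n(n-d+2)/2 & \text{if } n-d \text{ is even},\\ (n+1)(n-d+1)/2 & \text{if } n-d \text{ is odd}.\end{cases}$$ Then, as $q\to+\infty$ over the prime powers, $$\delta_q^{\mathrm{Sym}}(n\times n,k,d)\in O\left(q^{\frac{n(n+1)}2-k+1-n(d-1)+\frac{(d-1)(d-2)}2}\right).$$ Moreover, $$\lim_{q\to+\infty}\delta_q^{\mathrm{Sym}}(n\times n,k,d)=\begin{cases}1 & \text{if } k<\frac{n(n+1)}2+1-n(d-1)+\frac{(d-1)(d-2)}2,\\[2pt]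 0 & \text{if } k>\frac{n(n+1)}2+1-n(d-1)+\frac{(d-1)(d-2)}2.\end{cases}$$ In particular, for every $n\ge 2$, $\delta_q^{\mathrm{Sym}}(n\times n,n,n)\in O\left(q^{-n+2}\right)$ as $q\to+\infty$. -/

import Mathlib

open Filter Asymptotics Topology

namespace SymRankMetric

/-- The set of prime powers, ordered by size; `atTop` on it is the limit `q → +∞` taken over
prime powers. -/
abbrev PrimePower : Type := {q : ℕ // IsPrimePow q}

/-- `Sym_n(F)`: the space of symmetric `n × n` matrices over `F`. -/
def Sym (F : Type*) [Field F] (n : ℕ) : Submodule F (Matrix (Fin n) (Fin n) F) where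
  carrier := {M | M.IsSymm}
  zero_mem' := Matrix.isSymm_zero
  add_mem' hA hB := Matrix.IsSymm.add hA hB
  smul_mem' c _ hA := Matrix.IsSymm.smul hA c

/-- The minimum distance of a (nonzero, linear) rank-metric code: the least rank of a nonzero
codeword. -/
noncomputable def minDist {F : Type*} [Field F] {n : ℕ}
    (C : Submodule F (Matrix (Fin n) (Fin n) F)) : ℕ :=
  sInf {r : ℕ | ∃ M ∈ C, M ≠ 0 ∧ M.rank = r}

/-- The `k`-dimensional symmetric codes, that is, the `k`-dimensional subspaces of `Sym_n(F)`. -/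
def symCodes (F : Type*) [Field F] (n k : ℕ) :
    Set (Submodule F (Matrix (Fin n) (Fin n) F)) :=
  {C | C ≤ Sym F n ∧ Module.finrank F C = k}

/-- The density `δ^Sym(n × n, k, d)` over the field `F`: the proportion of codes of minimum
distance at least `d` among the `k`-dimensional symmetric codes (used for finite `F` and
`k ≥ 1`). -/
noncomputable def symDensity (F : Type*) [Field F] (n k d : ℕ) : ℝ :=
  (Set.ncard {C ∈ symCodes F n k | d ≤ minDist C} : ℝ) / (Set.ncard (symCodes F n k) : ℝ)

end SymRankMetric

/-! Put N = n(n+1)/2 = dim Sym_n and let B be the set of nonzero symmetric matrices of rank less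
than d. A k-dimensional code has minimum distance at least d exactly when it misses B, so the
density is the probability that a uniformly random k-dimensional subspace C avoids B.

Each nonzero vector lies in C with the same probability p, about q^(k-N), so |B ∩ C| has mean μ =
|B| p. As B is closed under nonzero scalars, a C that meets B contains at least q-1 elements of it.
The first moment then gives 1 - δ ≤ μ/(q-1) (`card_meeting_mul_le`). For linearly independent v and
w, the events v ∈ C and w ∈ C are not positively correlated, so only proportional pairs contribute
to the variance, which is at most (q-1)μ. Chebyshev then gives δ ≤ (q-1)/μ whenever μ > 0
(`card_avoiding_mul_le`).

It remains to see that |B| has order q^m with m = `rankDim n (d-1)` = n(d-1) - (d-1)(d-2)/2. The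
lower bound (`pow_rankDim_le_ncard`) borders smaller matrices with a nonzero pivot; the upper bound
(`ncard_symRankLE_le`) recovers a matrix from d-1 of its rows. Neither depends on the
characteristic. Hence, with e = N - k + 1 - m, the density is O(q^e) and its complement is
O(q^(-e)), and the sign of e decides the limit. -/

namespace SymRankMetric

/-! ### Counting subspaces through a given independent family -/

section Subspaces

variable {K V : Type*} [Field K] [AddCommGroup V] [Module K V]

/-- The general linear group acts transitively on linearly independent families. -/
theorem exists_linearEquiv_of_linearIndependent {j : ℕ} {v w : Fin j → V}
    (hv : LinearIndependent K v) (hw : LinearIndependent K w) :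
    ∃ g : V ≃ₗ[K] V, ∀ i, g (v i) = w i := by
  let f := hv.linearCombinationEquiv.symm ≪≫ₗ hw.linearCombinationEquiv
  have : FiniteDimensional K (Submodule.span K (Set.range v)) :=
    FiniteDimensional.span_of_finite K (Set.finite_range _)
  obtain ⟨g, hg⟩ := Submodule.exists_linearEquiv_restrict_eq f
  -- `g` extends to all of V the isomorphism of spans that matches the two families.
  refine ⟨g, fun i => ?_⟩
  have hi : (hv.linearCombinationEquiv (Finsupp.single i 1) : V) = v i := by simp
  rw [← hi, ← hg]
  simp [f]

variable [Fintype K] [Finite V]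

/-- For j above the dimension both sides vanish: the product contains the factor with i equal to the
dimension. This covers pairs inside a 1-dimensional subspace. -/
theorem card_linearIndependent' (j : ℕ) :
    Nat.card {s : Fin j → V // LinearIndependent K s} =
      ∏ i : Fin j, (Fintype.card K ^ Module.finrank K V - Fintype.card K ^ (i : ℕ)) := by
  by_cases h : j ≤ Module.finrank K V
  · exact card_linearIndependent h
  · push Not at h
    have : IsEmpty {s : Fin j → V // LinearIndependent K s} :=
      ⟨fun s => by simpa using (s.2.fintype_card_le_finrank).trans_lt h⟩
    rw [Nat.card_of_isEmpty, Finset.prod_eq_zero (Finset.mem_univ ⟨_, h⟩)]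
    simp

open Classical in
/-- The `k`-dimensional subspaces of a finite vector space. -/
noncomputable def subspaces (K V : Type*) [Field K] [AddCommGroup V] [Module K V] [Finite V]
    (k : ℕ) : Finset (Submodule K V) :=
  haveI := Fintype.ofFinite (Submodule K V)
  Finset.univ.filter fun C => Module.finrank K C = k

omit [Fintype K] in
theorem mem_subspaces {k : ℕ} {C : Submodule K V} :
    C ∈ subspaces K V k ↔ Module.finrank K C = k := by simp [subspaces]

open Classical in
omit [Fintype K] in
theorem card_subspaces_containing_eq (k : ℕ) {j : ℕ} {v w : Fin j → V}
    (hv : LinearIndependent K v) (hw : LinearIndependent K w) :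
    ((subspaces K V k).filter fun C => ∀ i, v i ∈ C).card =
      ((subspaces K V k).filter fun C => ∀ i, w i ∈ C).card := by
  obtain ⟨g, hg⟩ := exists_linearEquiv_of_linearIndependent hv hw
  refine Finset.card_bij' (fun C _ => C.map (g : V →ₗ[K] V))
    (fun C _ => C.map (g.symm : V →ₗ[K] V)) ?_ ?_ ?_ ?_
  · intro C hC
    simp only [Finset.mem_filter, mem_subspaces] at hC ⊢
    refine ⟨by rw [← hC.1]; exact LinearEquiv.finrank_map_eq g C, fun i => ?_⟩
    rw [← hg i]
    exact Submodule.mem_map_of_mem (hC.2 i)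
  · intro C hC
    simp only [Finset.mem_filter, mem_subspaces] at hC ⊢
    refine ⟨by rw [← hC.1]; exact LinearEquiv.finrank_map_eq g.symm C, fun i => ?_⟩
    have : v i = g.symm (w i) := by rw [← hg i]; simp
    rw [this]
    exact Submodule.mem_map_of_mem (hC.2 i)
  · intro C _
    rw [← Submodule.map_comp]; simp
  · intro C _
    rw [← Submodule.map_comp]; simp

open Classical in
/-- The number of `k`-dimensional subspaces containing a given linearly independent family. -/
theorem card_subspaces_containing (k : ℕ) {j : ℕ} {v : Fin j → V} (hv : LinearIndependent K v) :
    ((subspaces K V k).filter fun C => ∀ i, v i ∈ C).card *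
        ∏ i : Fin j, (Fintype.card K ^ Module.finrank K V - Fintype.card K ^ (i : ℕ)) =
      (subspaces K V k).card *
        ∏ i : Fin j, (Fintype.card K ^ k - Fintype.card K ^ (i : ℕ)) := by
  have := Fintype.ofFinite V
  set L : Finset (Fin j → V) := Finset.univ.filter fun s => LinearIndependent K s with hL
  have hLc : L.card =
      ∏ i : Fin j, (Fintype.card K ^ Module.finrank K V - Fintype.card K ^ (i : ℕ)) := by
    rw [← card_linearIndependent' (K := K) (V := V) j, Nat.card_eq_fintype_card,
      Fintype.card_subtype]
  -- Double count the pairs (w, C) with w an independent family contained in C. By transitivity the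
  -- count over a fixed w does not depend on w.
  have key := Finset.sum_card_bipartiteAbove_eq_sum_card_bipartiteBelow
    (s := L) (t := subspaces K V k) (fun (w : Fin j → V) (C : Submodule K V) => ∀ i, w i ∈ C)
  have h1 : ∀ w ∈ L, ((subspaces K V k).bipartiteAbove
      (fun (w : Fin j → V) (C : Submodule K V) => ∀ i, w i ∈ C) w).card =
      ((subspaces K V k).filter fun C => ∀ i, v i ∈ C).card := fun w hw =>
    card_subspaces_containing_eq k (by simpa [hL] using hw) hv
  have h2 : ∀ C ∈ subspaces K V k, (L.bipartiteBelow
      (fun (w : Fin j → V) (C : Submodule K V) => ∀ i, w i ∈ C) C).card =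
      ∏ i : Fin j, (Fintype.card K ^ k - Fintype.card K ^ (i : ℕ)) := by
    intro C hC
    rw [mem_subspaces] at hC
    rw [← hC, ← card_linearIndependent' (K := K) (V := C) j, Nat.card_eq_fintype_card,
      Fintype.card_subtype]
    symm
    refine Finset.card_bij (fun s _ i => (s i : V)) ?_ ?_ ?_
    · intro s hs
      simp only [Finset.mem_filter, Finset.mem_univ, true_and] at hs
      simp only [Finset.bipartiteBelow, hL, Finset.mem_filter, Finset.mem_univ, true_and]
      exact ⟨hs.map' C.subtype C.ker_subtype, fun i => (s i).2⟩
    · intro s _ t _ h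
      funext i
      exact Subtype.ext (congrFun h i)
    · intro w hw
      simp only [Finset.bipartiteBelow, hL, Finset.mem_filter, Finset.mem_univ, true_and] at hw
      refine ⟨fun i => ⟨w i, hw.2 i⟩, ?_, rfl⟩
      simp only [Finset.mem_filter, Finset.mem_univ, true_and]
      exact LinearIndependent.of_comp C.subtype hw.1
  rw [Finset.sum_congr rfl h1, Finset.sum_congr rfl h2] at key
  rw [← hLc, mul_comm]
  simpa using key

end Subspaces

/-! ### First and second moments of the number of elements of B in a random subspace -/

section Moments

variable {K V : Type*} [Field K] [AddCommGroup V] [Module K V] [Fintype K] [Finite V]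

/-- The probability that a fixed nonzero vector lies in a random `k`-dimensional subspace. -/
noncomputable def hitProb (K V : Type*) [Field K] [AddCommGroup V] [Module K V] [Fintype K]
    (k : ℕ) : ℝ :=
  ((Fintype.card K : ℝ) ^ k - 1) / ((Fintype.card K : ℝ) ^ Module.finrank K V - 1)

omit [Finite V] in
theorem hitProb_pos {k : ℕ} (hk : 1 ≤ k) (hkV : k ≤ Module.finrank K V) : 0 < hitProb K V k := by
  have hq : (1 : ℝ) < Fintype.card K := by exact_mod_cast Fintype.one_lt_card
  exact div_pos (sub_pos.2 (one_lt_pow₀ hq (by omega))) (sub_pos.2 (one_lt_pow₀ hq (by omega)))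

open Classical in
theorem card_subspaces_mem {k : ℕ} {v : V} (hv : v ≠ 0) :
    (((subspaces K V k).filter fun C => v ∈ C).card : ℝ) =
      (subspaces K V k).card * hitProb K V k := by
  have hli : LinearIndependent K ![v] := LinearIndependent.of_subsingleton 0 (by simpa using hv)
  have h := card_subspaces_containing (K := K) k hli
  have hq : (1 : ℝ) < Fintype.card K := by exact_mod_cast Fintype.one_lt_card
  have hN : Module.finrank K V ≠ 0 := by
    have := hli.fintype_card_le_finrank
    simp at this
    omega
  have hQ : (0 : ℝ) < (Fintype.card K : ℝ) ^ Module.finrank K V - 1 :=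
    sub_pos.2 (one_lt_pow₀ hq hN)
  have hc : ∀ m : ℕ, ((Fintype.card K ^ m - 1 : ℕ) : ℝ) = (Fintype.card K : ℝ) ^ m - 1 := by
    intro m
    rw [Nat.cast_sub (Nat.one_le_pow _ _ Fintype.card_pos)]
    simp
  simp only [Finset.univ_unique, Finset.prod_singleton, Fin.default_eq_zero, Fin.val_zero,
    pow_zero, Fin.forall_fin_one, Matrix.cons_val_zero] at h
  rw [hitProb, ← mul_div_assoc, eq_div_iff hQ.ne', ← hc, ← hc]
  exact_mod_cast h

-- The exact probability is p (q^k - q)/(q^N - q), with N the dimension of V, and the second factor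
-- is at most p = (q^k - 1)/(q^N - 1) because k ≤ N.
open Classical in
theorem card_subspaces_mem_mem_le {k : ℕ} (hk : 1 ≤ k) (hkV : k ≤ Module.finrank K V) {v w : V}
    (hvw : LinearIndependent K ![v, w]) :
    (((subspaces K V k).filter fun C => v ∈ C ∧ w ∈ C).card : ℝ) ≤
      (subspaces K V k).card * hitProb K V k ^ 2 := by
  have h := card_subspaces_containing (K := K) k hvw
  have hq : (1 : ℝ) < Fintype.card K := by exact_mod_cast Fintype.one_lt_card
  have hN : 2 ≤ Module.finrank K V := by simpa using hvw.fintype_card_le_finrank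
  have hQ : (0 : ℝ) < (Fintype.card K : ℝ) ^ Module.finrank K V - 1 :=
    sub_pos.2 (one_lt_pow₀ hq (by omega))
  have hQ' : (0 : ℝ) < (Fintype.card K : ℝ) ^ Module.finrank K V - Fintype.card K :=
    sub_pos.2 (by simpa using pow_lt_pow_right₀ hq (show 1 < Module.finrank K V by omega))
  have hP : (0 : ℝ) ≤ (Fintype.card K : ℝ) ^ k - 1 := sub_nonneg.2 (one_le_pow₀ hq.le)
  have hPQ : (Fintype.card K : ℝ) ^ k ≤ (Fintype.card K : ℝ) ^ Module.finrank K V :=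
    pow_le_pow_right₀ hq.le hkV
  have hc : ∀ m : ℕ, ((Fintype.card K ^ m - 1 : ℕ) : ℝ) = (Fintype.card K : ℝ) ^ m - 1 := by
    intro m
    rw [Nat.cast_sub (Nat.one_le_pow _ _ Fintype.card_pos)]
    simp
  have hc' : ∀ m : ℕ, 1 ≤ m →
      ((Fintype.card K ^ m - Fintype.card K : ℕ) : ℝ) = (Fintype.card K : ℝ) ^ m -
        Fintype.card K := by
    intro m hm
    rw [Nat.cast_sub (Nat.le_self_pow (by omega) _)]
    simp
  simp only [Fin.prod_univ_two, Fin.val_zero, Fin.val_one, pow_zero, pow_one, Fin.forall_fin_two,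
    Matrix.cons_val_zero, Matrix.cons_val_one] at h
  have h' := congrArg (Nat.cast (R := ℝ)) h
  rw [Nat.cast_mul, Nat.cast_mul, Nat.cast_mul, Nat.cast_mul, hc, hc, hc' _ hk,
    hc' _ (by omega)] at h'
  have hle : ((Fintype.card K : ℝ) ^ k - Fintype.card K) /
      ((Fintype.card K : ℝ) ^ Module.finrank K V - Fintype.card K) ≤ hitProb K V k := by
    rw [hitProb, div_le_div_iff₀ hQ' hQ]
    nlinarith [mul_le_mul_of_nonneg_left hPQ (sub_pos.2 hq).le]
  rw [← mul_assoc, ← mul_assoc] at h'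
  have heq : (((subspaces K V k).filter fun C => v ∈ C ∧ w ∈ C).card : ℝ) =
      (subspaces K V k).card * (hitProb K V k *
        (((Fintype.card K : ℝ) ^ k - Fintype.card K) /
          ((Fintype.card K : ℝ) ^ Module.finrank K V - Fintype.card K))) := by
    rw [hitProb]
    field_simp
    linarith
  rw [heq, pow_two]
  have hp := hitProb_pos (K := K) hk hkV
  gcongr

open Classical in
omit [Finite V] in
theorem card_filter_not_linearIndependent_le (B : Finset V) (h0 : (0 : V) ∉ B) {v : V}
    (hv : v ∈ B) :
    (B.filter fun w => ¬ LinearIndependent K ![v, w]).card ≤ Fintype.card K - 1 := by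
  have hv0 : v ≠ 0 := fun h => h0 (h ▸ hv)
  rw [← Fintype.card_units, ← Finset.card_univ]
  refine (Finset.card_le_card (t := Finset.univ.image fun a : Kˣ => (a : K) • v) ?_).trans
    Finset.card_image_le
  intro w hw
  rw [Finset.mem_filter, LinearIndependent.pair_iff' hv0] at hw
  obtain ⟨hwB, hw⟩ := hw
  push Not at hw
  obtain ⟨a, rfl⟩ := hw
  have ha : a ≠ 0 := by
    rintro rfl
    exact h0 (by simpa using hwB)
  exact Finset.mem_image.2 ⟨Units.mk0 a ha, Finset.mem_univ _, rfl⟩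

-- Linearity of expectation, as a double count of pairs (v, C) with v ∈ B ∩ C.
open Classical in
theorem sum_card_filter_mem (k : ℕ) (B : Finset V) (h0 : (0 : V) ∉ B) :
    ∑ C ∈ subspaces K V k, ((B.filter (· ∈ C)).card : ℝ) =
      (subspaces K V k).card * (B.card * hitProb K V k) := by
  have h := Finset.sum_card_bipartiteAbove_eq_sum_card_bipartiteBelow
    (s := B) (t := subspaces K V k) (fun (w : V) (C : Submodule K V) => w ∈ C)
  have h' := congrArg (Nat.cast (R := ℝ)) h
  rw [Nat.cast_sum, Nat.cast_sum] at h'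
  refine h'.symm.trans ?_
  have : ∀ v ∈ B, (((subspaces K V k).bipartiteAbove
      (fun (w : V) (C : Submodule K V) => w ∈ C) v).card : ℝ) =
      (subspaces K V k).card * hitProb K V k := fun v hv =>
    card_subspaces_mem fun h => h0 (h ▸ hv)
  rw [Finset.sum_congr rfl this, Finset.sum_const, nsmul_eq_mul]
  ring

-- The square counts ordered pairs from B lying in C. Each v has at most q-1 proportional partners,
-- each contributing at most p; every other pair contributes at most p².
open Classical in
theorem sum_card_filter_mem_sq_le {k : ℕ} (hk : 1 ≤ k) (hkV : k ≤ Module.finrank K V)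
    (B : Finset V) (h0 : (0 : V) ∉ B) :
    ∑ C ∈ subspaces K V k, ((B.filter (· ∈ C)).card : ℝ) ^ 2 ≤
      (subspaces K V k).card * ((B.card * hitProb K V k) * (Fintype.card K - 1) +
        (B.card * hitProb K V k) ^ 2) := by
  have h := Finset.sum_card_bipartiteAbove_eq_sum_card_bipartiteBelow
    (s := B ×ˢ B) (t := subspaces K V k)
    (fun (p : V × V) (C : Submodule K V) => p.1 ∈ C ∧ p.2 ∈ C)
  have h' := congrArg (Nat.cast (R := ℝ)) h
  rw [Nat.cast_sum, Nat.cast_sum, Finset.sum_product] at h'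
  have hsq : ∀ C ∈ subspaces K V k, ((B.filter (· ∈ C)).card : ℝ) ^ 2 =
      (((B ×ˢ B).bipartiteBelow
        (fun (p : V × V) (C : Submodule K V) => p.1 ∈ C ∧ p.2 ∈ C) C).card : ℝ) := by
    intro C _
    rw [Finset.bipartiteBelow, Finset.filter_product, Finset.card_product, pow_two]
    push_cast
    rfl
  rw [Finset.sum_congr rfl hsq, ← h']
  have hp := hitProb_pos (K := K) hk hkV
  set T := ((subspaces K V k).card : ℝ)
  set p := hitProb K V k
  have hT : 0 ≤ T := Nat.cast_nonneg _
  have hrow : ∀ v ∈ B, ∑ w ∈ B, (((subspaces K V k).bipartiteAbove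
      (fun (p : V × V) (C : Submodule K V) => p.1 ∈ C ∧ p.2 ∈ C) (v, w)).card : ℝ) ≤
      (Fintype.card K - 1) * (T * p) + B.card * (T * p ^ 2) := by
    intro v hv
    have hv0 : v ≠ 0 := fun h => h0 (h ▸ hv)
    have hpt : ∀ w ∈ B, (((subspaces K V k).bipartiteAbove
        (fun (p : V × V) (C : Submodule K V) => p.1 ∈ C ∧ p.2 ∈ C) (v, w)).card : ℝ) ≤
        (if ¬ LinearIndependent K ![v, w] then T * p else 0) + T * p ^ 2 := by
      intro w _
      by_cases hli : LinearIndependent K ![v, w]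
      · rw [if_neg (not_not.2 hli), zero_add]
        exact card_subspaces_mem_mem_le hk hkV hli
      · rw [if_pos hli]
        have hle : (((subspaces K V k).bipartiteAbove
            (fun (p : V × V) (C : Submodule K V) => p.1 ∈ C ∧ p.2 ∈ C) (v, w)).card : ℝ) ≤
            T * p := by
          rw [← card_subspaces_mem hv0]
          exact Nat.cast_le.2 (Finset.card_le_card fun C hC =>
            Finset.mem_filter.2 ⟨(Finset.mem_filter.1 hC).1, (Finset.mem_filter.1 hC).2.1⟩)
        have : 0 ≤ T * p ^ 2 := by positivity
        linarith
    refine (Finset.sum_le_sum hpt).trans ?_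
    rw [Finset.sum_add_distrib, ← Finset.sum_filter, Finset.sum_const, Finset.sum_const,
      nsmul_eq_mul, nsmul_eq_mul]
    have hcard : ((B.filter fun w => ¬ LinearIndependent K ![v, w]).card : ℝ) ≤
        Fintype.card K - 1 := by
      have := card_filter_not_linearIndependent_le (K := K) B h0 hv
      rw [← Nat.cast_one, ← Nat.cast_sub Fintype.card_pos]
      exact_mod_cast this
    gcongr
  refine (Finset.sum_le_sum hrow).trans (le_of_eq ?_)
  rw [Finset.sum_const, nsmul_eq_mul]
  ring

/-- The subspace `C` contains no element of `B`. -/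
def Avoids (B : Finset V) (C : Submodule K V) : Prop := ∀ v ∈ B, v ∉ C

open Classical in
/-- Second moment bound for the subspaces avoiding `B`. -/
theorem card_avoiding_mul_le {k : ℕ} (hk : 1 ≤ k) (hkV : k ≤ Module.finrank K V)
    (B : Finset V) (h0 : (0 : V) ∉ B) :
    (((subspaces K V k).filter fun C => Avoids B C).card : ℝ) *
        (B.card * hitProb K V k) ≤ (subspaces K V k).card * (Fintype.card K - 1) := by
  have h1 := sum_card_filter_mem (K := K) k B h0
  have h2 := sum_card_filter_mem_sq_le hk hkV B h0
  have hq : (1 : ℝ) < Fintype.card K := by exact_mod_cast Fintype.one_lt_card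
  have hp := hitProb_pos (K := K) hk hkV
  set T := ((subspaces K V k).card : ℝ)
  set μ : ℝ := B.card * hitProb K V k with hμ
  have hμ0 : 0 ≤ μ := by positivity
  rcases hμ0.eq_or_lt with h | hμpos
  · rw [← h, mul_zero]
    exact mul_nonneg (Nat.cast_nonneg _) (by linarith)
  have hvar : ∑ C ∈ subspaces K V k, (((B.filter (· ∈ C)).card : ℝ) - μ) ^ 2 ≤
      T * (μ * (Fintype.card K - 1)) := by
    have : ∑ C ∈ subspaces K V k, (((B.filter (· ∈ C)).card : ℝ) - μ) ^ 2 =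
        ∑ C ∈ subspaces K V k, ((B.filter (· ∈ C)).card : ℝ) ^ 2 -
          2 * μ * ∑ C ∈ subspaces K V k, ((B.filter (· ∈ C)).card : ℝ) + T * μ ^ 2 := by
      rw [Finset.mul_sum, ← Finset.sum_sub_distrib, ← nsmul_eq_mul, ← Finset.sum_const,
        ← Finset.sum_add_distrib]
      exact Finset.sum_congr rfl fun C _ => by ring
    rw [this, h1]
    linarith
  -- Chebyshev: a subspace avoiding B deviates from the mean by exactly μ.
  have hlow : (((subspaces K V k).filter fun C => Avoids B C).card : ℝ) * μ ^ 2 ≤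
      ∑ C ∈ subspaces K V k, (((B.filter (· ∈ C)).card : ℝ) - μ) ^ 2 := by
    rw [← nsmul_eq_mul, ← Finset.sum_const]
    refine le_trans (Finset.sum_le_sum fun C hC => ?_)
      (Finset.sum_le_sum_of_subset_of_nonneg (Finset.filter_subset _ _)
        fun C _ _ => sq_nonneg _)
    rw [Finset.filter_eq_empty_iff.2 fun v hv => (Finset.mem_filter.1 hC).2 v hv]
    simp
  refine le_of_mul_le_mul_right ?_ hμpos
  calc _ = (((subspaces K V k).filter fun C => Avoids B C).card : ℝ) * μ ^ 2 := by ring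
    _ ≤ T * (μ * (Fintype.card K - 1)) := hlow.trans hvar
    _ = _ := by ring

open Classical in
/-- First moment bound for the subspaces meeting `B`. -/
theorem card_meeting_mul_le (k : ℕ) (B : Finset V) (h0 : (0 : V) ∉ B)
    (hB : ∀ (a : Kˣ), ∀ v ∈ B, (a : K) • v ∈ B) :
    (((subspaces K V k).filter fun C => ¬ Avoids B C).card : ℝ) * (Fintype.card K - 1) ≤
      (subspaces K V k).card * (B.card * hitProb K V k) := by
  rw [← sum_card_filter_mem k B h0, ← nsmul_eq_mul, ← Finset.sum_const]
  refine le_trans (Finset.sum_le_sum fun C hC => ?_)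
    (Finset.sum_le_sum_of_subset_of_nonneg (Finset.filter_subset _ _)
      fun C _ _ => Nat.cast_nonneg _)
  have hC' := (Finset.mem_filter.1 hC).2
  simp only [Avoids] at hC'
  push Not at hC'
  obtain ⟨v, hv, hvC⟩ := hC'
  have hv0 : v ≠ 0 := fun h => h0 (h ▸ hv)
  -- The unit multiples of v are q-1 distinct elements of B ∩ C.
  rw [← Nat.cast_one, ← Nat.cast_sub Fintype.card_pos, ← Fintype.card_units, ← Finset.card_univ]
  have hinj : Function.Injective fun a : Kˣ => (a : K) • v := fun a b hab =>
    Units.ext (smul_left_injective K hv0 hab)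
  rw [← Finset.card_image_of_injective _ hinj]
  refine Nat.cast_le.2 (Finset.card_le_card fun w hw => ?_)
  obtain ⟨a, -, rfl⟩ := Finset.mem_image.1 hw
  exact Finset.mem_filter.2 ⟨hB a v hv, C.smul_mem _ hvC⟩

omit [Fintype K] in
theorem card_subspaces_pos {k : ℕ} (hkV : k ≤ Module.finrank K V) :
    0 < (subspaces K V k).card := by
  obtain ⟨f, hf⟩ := exists_linearIndependent_of_le_finrank hkV
  exact Finset.card_pos.2 ⟨Submodule.span K (Set.range f),
    mem_subspaces.2 (by simpa using finrank_span_eq_card hf)⟩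

end Moments

/-! ### Counting symmetric matrices of bounded rank -/

section Rank

variable {F : Type*} [Field F]

theorem rank_add_le {m n : ℕ} (A B : Matrix (Fin m) (Fin n) F) :
    (A + B).rank ≤ A.rank + B.rank := by
  have h : LinearMap.range (A + B).mulVecLin ≤
      LinearMap.range A.mulVecLin ⊔ LinearMap.range B.mulVecLin := by
    rw [Matrix.mulVecLin_add]
    exact LinearMap.range_add_le _ _
  exact (Submodule.finrank_mono h).trans (Submodule.finrank_add_le_finrank_add_finrank _ _)

/-- The symmetric matrices of rank at most `r`. -/
def symRankLE (F : Type*) [Field F] (n r : ℕ) : Set (Matrix (Fin n) (Fin n) F) :=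
  {M | M.IsSymm ∧ M.rank ≤ r}

/-- The inclusion of the last `n` coordinates into `n + 1` coordinates. -/
def shiftMatrix (F : Type*) [Field F] (n : ℕ) : Matrix (Fin (n + 1)) (Fin n) F :=
  Matrix.of fun i j => if i = j.succ then 1 else 0

/-- The symmetric matrix with first row `(a, w)` and Schur complement `M`. -/
noncomputable def border {n : ℕ} (a : F) (w : Fin n → F) (M : Matrix (Fin n) (Fin n) F) :
    Matrix (Fin (n + 1)) (Fin (n + 1)) F :=
  Matrix.vecMulVec (Fin.cons a w) (a⁻¹ • (Fin.cons a w : Fin (n + 1) → F)) +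
    shiftMatrix F n * M * (shiftMatrix F n).transpose

theorem border_zero_zero {n : ℕ} {a : F} (ha : a ≠ 0) (w : Fin n → F)
    (M : Matrix (Fin n) (Fin n) F) : border a w M 0 0 = a := by
  have h : ∀ i : Fin n, (0 : Fin (n + 1)) ≠ i.succ := fun i => (Fin.succ_ne_zero i).symm
  simp [border, Matrix.vecMulVec_apply, Matrix.mul_apply, shiftMatrix, ha, h]

theorem border_succ_zero {n : ℕ} {a : F} (ha : a ≠ 0) (w : Fin n → F)
    (M : Matrix (Fin n) (Fin n) F) (i : Fin n) : border a w M i.succ 0 = w i := by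
  have h : ∀ i : Fin n, (0 : Fin (n + 1)) ≠ i.succ := fun i => (Fin.succ_ne_zero i).symm
  simp [border, Matrix.vecMulVec_apply, Matrix.mul_apply, shiftMatrix, h]
  field_simp

theorem border_succ_succ {n : ℕ} (a : F) (w : Fin n → F)
    (M : Matrix (Fin n) (Fin n) F) (i j : Fin n) :
    border a w M i.succ j.succ = w i * (a⁻¹ * w j) + M i j := by
  simp [border, Matrix.vecMulVec_apply, Matrix.mul_apply, shiftMatrix]
  ring

theorem border_mem {n r : ℕ} (a : F) (w : Fin n → F) {M : Matrix (Fin n) (Fin n) F}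
    (hM : M ∈ symRankLE F n r) : border a w M ∈ symRankLE F (n + 1) (r + 1) := by
  constructor
  · have : M.transpose = M := hM.1
    unfold border Matrix.IsSymm
    rw [Matrix.transpose_add, Matrix.transpose_mul, Matrix.transpose_mul,
      Matrix.transpose_transpose, this, Matrix.mul_assoc]
    congr 1
    ext i j
    simp only [Matrix.transpose_apply, Matrix.vecMulVec_apply, Pi.smul_apply, smul_eq_mul]
    ring
  · refine (rank_add_le _ _).trans ?_
    have h1 := Matrix.rank_vecMulVec_le (Fin.cons a w : Fin (n + 1) → F)
      (a⁻¹ • (Fin.cons a w : Fin (n + 1) → F))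
    have h2 := ((Matrix.rank_mul_le_left (shiftMatrix F n * M) (shiftMatrix F n).transpose).trans
      (Matrix.rank_mul_le_right _ _)).trans hM.2
    omega

theorem border_injective {n : ℕ} {a b : F} (ha : a ≠ 0) (hb : b ≠ 0) {v w : Fin n → F}
    {M N : Matrix (Fin n) (Fin n) F} (h : border a v M = border b w N) :
    a = b ∧ v = w ∧ M = N := by
  have h0 : a = b := by rw [← border_zero_zero ha v M, h, border_zero_zero hb]
  have h1 : v = w := by
    funext i
    rw [← border_succ_zero ha v M i, h, border_succ_zero hb]
  refine ⟨h0, h1, ?_⟩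
  ext i j
  have := congrFun (congrFun h i.succ) j.succ
  rw [border_succ_succ, border_succ_succ, h0, h1] at this
  exact add_left_cancel this

variable [Fintype F]

/-- The first column with nonzero pivot and the Schur complement determine a bordered matrix and can
be chosen freely; the bordering raises the rank by at most one. -/
theorem card_mul_ncard_symRankLE_le (n r : ℕ) :
    (Fintype.card F - 1) * Fintype.card F ^ n * (symRankLE F n r).ncard ≤
      (symRankLE F (n + 1) (r + 1)).ncard := by
  classical
  have hdom : Nat.card (Fˣ × (Fin n → F) × symRankLE F n r) =
      (Fintype.card F - 1) * Fintype.card F ^ n * (symRankLE F n r).ncard := by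
    rw [Nat.card_prod, Nat.card_prod, Nat.card_eq_fintype_card, Fintype.card_units,
      Nat.card_eq_fintype_card (α := Fin n → F), Fintype.card_fun, Fintype.card_fin, mul_assoc]
    rfl
  rw [← hdom]
  refine Nat.card_le_card_of_injective (β := symRankLE F (n + 1) (r + 1))
    (fun p => ⟨border (p.1 : F) p.2.1 p.2.2, border_mem _ _ p.2.2.2⟩) ?_
  rintro ⟨a, v, M⟩ ⟨b, w, N⟩ h
  obtain ⟨h1, h2, h3⟩ := border_injective a.ne_zero b.ne_zero (congrArg Subtype.val h)
  simp only [Prod.mk.injEq]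
  exact ⟨Units.ext h1, h2, Subtype.ext h3⟩

/-- The number of unordered pairs from `Fin n` meeting a fixed set of size `r`: the dimension of
the variety of symmetric matrices of rank at most `r`. -/
def rankDim (n r : ℕ) : ℕ := (n + 1).choose 2 - (n - r + 1).choose 2

/-- Iterate the bordering r times. Each step costs a factor 2, from q ≤ 2(q-1). -/
theorem pow_rankDim_le_ncard (n r : ℕ) (hr : r ≤ n) :
    Fintype.card F ^ rankDim n r ≤ 2 ^ r * (symRankLE F n r).ncard := by
  induction r generalizing n with
  | zero =>
    have h0 : (0 : Matrix (Fin n) (Fin n) F) ∈ symRankLE F n 0 :=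
      ⟨Matrix.isSymm_zero, by simp⟩
    have := (Set.ncard_pos (Set.toFinite _)).2 ⟨_, h0⟩
    simp only [rankDim, Nat.sub_zero, Nat.sub_self, pow_zero, one_mul]
    exact this
  | succ r ih =>
    obtain ⟨n, rfl⟩ : ∃ m, n = m + 1 := ⟨n - 1, by omega⟩
    have hr' : r ≤ n := by omega
    have hm : rankDim (n + 1) (r + 1) = n + 1 + rankDim n r := by
      have h1 : (n - r + 1).choose 2 ≤ (n + 1).choose 2 := Nat.choose_le_choose 2 (by omega)
      have h2 : (n + 1 + 1).choose 2 = (n + 1) + (n + 1).choose 2 := by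
        rw [Nat.choose_succ_succ' (n + 1) 1]; simp
      have h3 : n + 1 - (r + 1) = n - r := by omega
      simp only [rankDim, h2, h3]
      omega
    have hq : Fintype.card F ≤ 2 * (Fintype.card F - 1) := by
      have := Fintype.one_lt_card (α := F)
      omega
    calc Fintype.card F ^ rankDim (n + 1) (r + 1)
        = Fintype.card F * Fintype.card F ^ n * Fintype.card F ^ rankDim n r := by
          rw [hm, pow_add, pow_succ]; ring
      _ ≤ 2 * (Fintype.card F - 1) * Fintype.card F ^ n *
            (2 ^ r * (symRankLE F n r).ncard) :=
          Nat.mul_le_mul (Nat.mul_le_mul_right _ hq) (ih n hr')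
      _ = 2 ^ (r + 1) * ((Fintype.card F - 1) * Fintype.card F ^ n * (symRankLE F n r).ncard) := by
          ring
      _ ≤ _ := Nat.mul_le_mul_left _ (card_mul_ncard_symRankLE_le n r)

omit [Fintype F] in
/-- A symmetric matrix is determined by any set of rows spanning its row space. -/
theorem eq_of_rows_eq {n : ℕ} {M N : Matrix (Fin n) (Fin n) F} (hM : M.IsSymm) (hN : N.IsSymm)
    {I : Finset (Fin n)} (hMI : ∀ i, M.row i ∈ Submodule.span F (M.row '' I))
    (hNI : ∀ i, N.row i ∈ Submodule.span F (N.row '' I)) (h : ∀ i ∈ I, M.row i = N.row i) :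
    M = N := by
  classical
  have ker : ∀ {A : Matrix (Fin n) (Fin n) F},
      (∀ i, A.row i ∈ Submodule.span F (A.row '' I)) →
      ∀ c : Fin n → F, (∀ i ∈ I, A.row i ⬝ᵥ c = 0) → ∀ i, A.row i ⬝ᵥ c = 0 := by
    intro A hA c hc i
    refine Submodule.span_induction (p := fun x _ => x ⬝ᵥ c = 0) ?_ (by simp)
      (fun x y _ _ hx hy => by simp [hx, hy]) (fun a x _ hx => by simp [hx]) (hA i)
    rintro _ ⟨j, hj, rfl⟩
    exact hc j hj
  refine Matrix.ext fun k l => ?_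
  suffices hk : M.row k = N.row k from congrFun hk l
  -- By symmetry, the relation expressing row k through the rows in I says that c - e_k lies in the
  -- kernel of M. Membership in the kernel is tested on the rows in I alone, where M and N agree, so
  -- N satisfies the same relation.
  obtain ⟨c, hcs, hc⟩ : ∃ c : Fin n → F, (∀ j ∉ I, c j = 0) ∧ ∑ j, c j • M.row j = M.row k := by
    have := hMI k
    rw [Submodule.mem_span_image_finset_iff_exists_fun] at this
    obtain ⟨c, hc⟩ := this
    refine ⟨fun j => if hj : j ∈ I then c ⟨j, hj⟩ else 0, fun j hj => by simp [hj], ?_⟩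
    rw [← hc, ← Finset.sum_subset (Finset.subset_univ I) fun j _ hj => by simp [hj],
      ← Finset.sum_coe_sort I]
    simp
  have hsum : ∀ (A : Matrix (Fin n) (Fin n) F), A.IsSymm → ∀ i,
      A.row i ⬝ᵥ (c - Pi.single k 1) = (∑ j, c j • A.row j) i - A.row k i := by
    intro A hA i
    rw [dotProduct_sub, dotProduct_single_one, Finset.sum_apply]
    simp only [Pi.smul_apply, smul_eq_mul, dotProduct, Matrix.row_apply]
    rw [hA.apply k i]
    congr 1
    exact Finset.sum_congr rfl fun j _ => by rw [hA.apply j i, mul_comm]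
  have hkM : ∀ i, M.row i ⬝ᵥ (c - Pi.single k 1) = 0 := fun i => by
    rw [hsum M hM, hc, sub_self]
  have hkN := ker hNI (c - Pi.single k 1) fun i hi => by rw [← h i hi]; exact hkM i
  have hN' : ∑ j, c j • N.row j = N.row k := by
    funext i
    exact sub_eq_zero.1 ((hsum N hN i).symm.trans (hkN i))
  rw [← hc, ← hN']
  refine Finset.sum_congr rfl fun j _ => ?_
  by_cases hj : j ∈ I
  · rw [h j hj]
  · simp [hcs j hj]

omit [Fintype F] in
theorem exists_spanning_rows {n r : ℕ} (hr : r ≤ n) {M : Matrix (Fin n) (Fin n) F}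
    (hM : M.rank ≤ r) :
    ∃ I : Finset (Fin n), I.card = r ∧ ∀ i, M.row i ∈ Submodule.span F (M.row '' I) := by
  classical
  obtain ⟨t, ht, htc, hts, -⟩ := Submodule.exists_finset_span_eq_linearIndepOn F (Set.range M.row)
  have htr : t.card ≤ r := by
    rw [htc]
    exact (M.rank_eq_finrank_span_row).symm.le.trans hM
  choose g hg using ht
  have hJc : (t.attach.image fun x => g x.2).card ≤ r :=
    Finset.card_image_le.trans (by simpa using htr)
  obtain ⟨I, hJI, hI⟩ := Finset.exists_superset_card_eq hJc (by simpa using hr)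
  refine ⟨I, hI, fun i => ?_⟩
  have : M.row i ∈ Submodule.span F (t : Set (Fin n → F)) := by
    rw [hts]; exact Submodule.subset_span ⟨i, rfl⟩
  refine Submodule.span_mono (fun x hx => ?_) this
  exact ⟨g hx, hJI (Finset.mem_image.2 ⟨⟨x, hx⟩, Finset.mem_attach _ _, rfl⟩), hg hx⟩

/-- Take a union over the r-sets I of rows that can span the row space. For fixed I the matrix is
determined by its entries at the unordered pairs meeting I, and there are `rankDim n r` of these. -/
theorem ncard_symRankLE_le (n r : ℕ) (hr : r ≤ n) :
    (symRankLE F n r).ncard ≤ n.choose r * Fintype.card F ^ rankDim n r := by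
  classical
  set P : Finset (Fin n) → Set (Matrix (Fin n) (Fin n) F) := fun I =>
    {M | M.IsSymm ∧ ∀ i, M.row i ∈ Submodule.span F (M.row '' I)}
  have hsub : symRankLE F n r ⊆
      ⋃ I ∈ Finset.powersetCard r (Finset.univ : Finset (Fin n)), P I := by
    intro M hM
    obtain ⟨I, hI, h⟩ := exists_spanning_rows hr hM.2
    simp only [Set.mem_iUnion, Finset.mem_powersetCard_univ]
    exact ⟨I, hI, hM.1, h⟩
  have hP : ∀ I ∈ Finset.powersetCard r (Finset.univ : Finset (Fin n)),
      (P I).ncard ≤ Fintype.card F ^ rankDim n r := by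
    intro I hI
    rw [Finset.mem_powersetCard_univ] at hI
    have hc : ((Iᶜ.sym2)ᶜ : Finset (Sym2 (Fin n))).card = rankDim n r := by
      rw [Finset.card_compl, Finset.card_sym2, Finset.card_compl, Sym2.card, hI, Fintype.card_fin]
      rfl
    have : Fintype.card F ^ rankDim n r =
        Nat.card (((Iᶜ.sym2)ᶜ : Finset (Sym2 (Fin n))) → F) := by
      rw [Nat.card_eq_fintype_card, Fintype.card_fun, Fintype.card_coe, hc]
    rw [this]
    refine Nat.card_le_card_of_injective (α := P I)
      (fun M p => Sym2.lift ⟨fun i j => M.1 i j, fun i j => M.2.1.apply j i⟩ p.1) ?_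
    intro M N h
    refine Subtype.ext (eq_of_rows_eq M.2.1 N.2.1 M.2.2 N.2.2 fun i hi => ?_)
    funext j
    exact congrFun h ⟨s(i, j), by simp [hi]⟩
  calc (symRankLE F n r).ncard ≤ (⋃ I ∈ Finset.powersetCard r Finset.univ, P I).ncard :=
        Set.ncard_le_ncard hsub (Set.toFinite _)
    _ ≤ ∑ I ∈ Finset.powersetCard r Finset.univ, (P I).ncard := Finset.set_ncard_biUnion_le _ _
    _ ≤ _ := by
      refine (Finset.sum_le_card_nsmul _ _ _ hP).trans ?_
      simp

end Rank

/-! ### From codes to avoiding subspaces, and bounds for a fixed field -/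

section Density

variable {F : Type*} [Field F]

/-- Symmetric matrices as functions on unordered pairs of indices. -/
def symEquiv (F : Type*) [Field F] (n : ℕ) : Sym F n ≃ₗ[F] (Sym2 (Fin n) → F) where
  toFun M := Sym2.lift ⟨fun i j => M.1 i j, fun i j => Matrix.IsSymm.apply M.2 j i⟩
  map_add' M N := by
    funext p
    induction p with | _ i j => rfl
  map_smul' a M := by
    funext p
    induction p with | _ i j => rfl
  invFun f := ⟨Matrix.of fun i j => f s(i, j), by
    ext i j
    simp [Sym2.eq_swap]⟩
  left_inv M := rfl
  right_inv f := by
    funext p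
    induction p with | _ i j => rfl

theorem finrank_sym (n : ℕ) : Module.finrank F (Sym F n) = (n + 1).choose 2 := by
  rw [(symEquiv F n).finrank_eq, Module.finrank_fintype_fun_eq_card, Sym2.card, Fintype.card_fin]

theorem le_minDist_iff {n d : ℕ} {C : Submodule F (Matrix (Fin n) (Fin n) F)} (hC : C ≠ ⊥) :
    d ≤ minDist C ↔ ∀ M ∈ C, M ≠ 0 → d ≤ M.rank := by
  constructor
  · exact fun h M hM hM0 => h.trans (Nat.sInf_le ⟨M, hM, hM0, rfl⟩)
  · intro h
    obtain ⟨M, hM, hM0⟩ := C.ne_bot_iff.1 hC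
    refine le_csInf ⟨_, M, hM, hM0, rfl⟩ ?_
    rintro _ ⟨N, hN, hN0, rfl⟩
    exact h N hN hN0

variable [Fintype F]

open Classical in
/-- The nonzero symmetric matrices of rank less than `d`. -/
noncomputable def lowRank (F : Type*) [Field F] [Fintype F] (n d : ℕ) : Finset (Sym F n) :=
  have := Fintype.ofFinite (Sym F n)
  Finset.univ.filter fun M => M ≠ 0 ∧ M.1.rank < d

theorem mem_lowRank {n d : ℕ} {M : Sym F n} : M ∈ lowRank F n d ↔ M ≠ 0 ∧ M.1.rank < d := by
  simp [lowRank]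

theorem zero_notMem_lowRank (n d : ℕ) : (0 : Sym F n) ∉ lowRank F n d :=
  fun h => (mem_lowRank.1 h).1 rfl

theorem smul_mem_lowRank {n d : ℕ} (a : Fˣ) {M : Sym F n} (hM : M ∈ lowRank F n d) :
    (a : F) • M ∈ lowRank F n d := by
  rw [mem_lowRank] at hM ⊢
  refine ⟨smul_ne_zero a.ne_zero hM.1, lt_of_le_of_lt ?_ hM.2⟩
  have : ((a : F) • M).1 = Matrix.diagonal (fun _ => (a : F)) * M.1 := by
    ext i j
    simp
  rw [this]
  exact Matrix.rank_mul_le_right _ _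

theorem card_lowRank_add_one (n r : ℕ) :
    (lowRank F n (r + 1)).card + 1 = (symRankLE F n r).ncard := by
  classical
  have h : symRankLE F n r =
      ((insert 0 (lowRank F n (r + 1))).map (Function.Embedding.subtype _) :
        Finset (Matrix (Fin n) (Fin n) F)) := by
    ext M
    simp only [Finset.coe_map, Set.mem_image, Finset.mem_coe, Finset.mem_insert, mem_lowRank,
      Nat.lt_succ_iff]
    constructor
    · intro hM
      refine ⟨⟨M, hM.1⟩, ?_, rfl⟩
      by_cases h0 : (⟨M, hM.1⟩ : Sym F n) = 0
      · exact Or.inl h0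
      · exact Or.inr ⟨h0, hM.2⟩
    · rintro ⟨M, rfl | hM, rfl⟩
      · exact ⟨Matrix.isSymm_zero, by simp⟩
      · exact ⟨M.2, hM.2⟩
  rw [h, Set.ncard_coe_finset, Finset.card_map,
    Finset.card_insert_of_notMem (zero_notMem_lowRank _ _)]

/-- The extra factor 2 pays for discarding the zero matrix, once at least two matrices are known to
be counted. -/
theorem pow_rankDim_le_card_lowRank {n r : ℕ} (hn : 2 ≤ n) (hr : 1 ≤ r) (hrn : r ≤ n) :
    Fintype.card F ^ rankDim n r ≤ 2 ^ (r + 1) * (lowRank F n (r + 1)).card := by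
  have h1 := pow_rankDim_le_ncard (F := F) n r hrn
  have h2 := card_lowRank_add_one (F := F) n r
  have hq := Fintype.one_lt_card (α := F)
  have h3 : 2 ≤ (symRankLE F n r).ncard := by
    obtain ⟨n, rfl⟩ : ∃ m, n = m + 1 := ⟨n - 1, by omega⟩
    obtain ⟨r, rfl⟩ : ∃ m, r = m + 1 := ⟨r - 1, by omega⟩
    refine le_trans ?_ (card_mul_ncard_symRankLE_le (F := F) n r)
    have h0 : (0 : Matrix (Fin n) (Fin n) F) ∈ symRankLE F n r :=
      ⟨Matrix.isSymm_zero, by simp⟩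
    have ha := (Set.ncard_pos (Set.toFinite _)).2 ⟨_, h0⟩
    have hb : 2 ≤ Fintype.card F ^ n := hq.trans_le (Nat.le_self_pow (by omega) _)
    calc 2 = 1 * 2 * 1 := rfl
      _ ≤ _ := Nat.mul_le_mul (Nat.mul_le_mul (by omega) hb) ha
  calc _ ≤ 2 ^ r * (symRankLE F n r).ncard := h1
    _ ≤ 2 ^ r * (2 * (lowRank F n (r + 1)).card) := Nat.mul_le_mul_left _ (by omega)
    _ = _ := by ring

-- Here k ≥ 1 matters: the zero code would have `minDist` equal to `sInf ∅ = 0`, although it avoids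
-- every set of nonzero matrices.
open Classical in
theorem symDensity_eq {n k : ℕ} (hk : 1 ≤ k) (d : ℕ) :
    symDensity F n k d =
      (((subspaces F (Sym F n) k).filter fun C => Avoids (lowRank F n d) C).card : ℝ) /
        (subspaces F (Sym F n) k).card := by
  have hinj : Function.Injective (Submodule.map (Sym F n).subtype) :=
    Submodule.map_injective_of_injective (Sym F n).injective_subtype
  have hfin : ∀ C : Submodule F (Sym F n),
      Module.finrank F (C.map (Sym F n).subtype) = Module.finrank F C := fun C =>
    Submodule.finrank_map_subtype_eq _ _
  have h1 : symCodes F n k = Submodule.map (Sym F n).subtype '' ↑(subspaces F (Sym F n) k) := by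
    ext C
    simp only [symCodes, Set.mem_ofPred_eq, Set.mem_image, Finset.mem_coe, mem_subspaces]
    constructor
    · rintro ⟨hC, hCk⟩
      have hmap : (C.comap (Sym F n).subtype).map (Sym F n).subtype = C :=
        Submodule.map_comap_eq_of_le (by simpa using hC)
      exact ⟨C.comap (Sym F n).subtype, by rw [← hfin, hmap, hCk], hmap⟩
    · rintro ⟨C, hC, rfl⟩
      exact ⟨Submodule.map_subtype_le _ _, by rw [hfin, hC]⟩
  have h2 : {C ∈ symCodes F n k | d ≤ minDist C} = Submodule.map (Sym F n).subtype ''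
      ↑((subspaces F (Sym F n) k).filter fun C => Avoids (lowRank F n d) C) := by
    have key : ∀ C ∈ subspaces F (Sym F n) k, d ≤ minDist (C.map (Sym F n).subtype) ↔
        Avoids (lowRank F n d) C := by
      intro C hC
      rw [mem_subspaces] at hC
      have hne : C.map (Sym F n).subtype ≠ ⊥ := by
        intro h
        have := hfin C
        rw [h, finrank_bot] at this
        omega
      rw [le_minDist_iff hne]
      constructor
      · intro h M hM hMC
        rw [mem_lowRank] at hM
        refine absurd (h M.1 (Submodule.mem_map_of_mem hMC) fun h0 => hM.1 (Subtype.ext h0)) ?_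
        omega
      · rintro h _ ⟨M, hM, rfl⟩ hM0
        by_contra hlt
        exact h M (mem_lowRank.2 ⟨fun h0 => hM0 (by simp [h0]), not_le.1 hlt⟩) hM
    ext C
    rw [h1]
    simp only [Set.mem_ofPred_eq, Set.mem_image, Finset.mem_coe, Finset.mem_filter]
    constructor
    · rintro ⟨⟨C, hC, rfl⟩, hd⟩
      exact ⟨C, ⟨hC, (key C hC).1 hd⟩, rfl⟩
    · rintro ⟨C, ⟨hC, hd⟩, rfl⟩
      exact ⟨⟨C, hC, rfl⟩, (key C hC).2 hd⟩
  rw [symDensity, h2, h1, Set.ncard_image_of_injective _ hinj, Set.ncard_image_of_injective _ hinj,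
    Set.ncard_coe_finset, Set.ncard_coe_finset]

variable {n k r : ℕ}

theorem hitProb_le (hk : 1 ≤ k) (hkn : k ≤ (n + 1).choose 2) :
    hitProb F (Sym F n) k ≤
      (Fintype.card F : ℝ) ^ k / (Fintype.card F : ℝ) ^ (n + 1).choose 2 := by
  have hq : (1 : ℝ) < Fintype.card F := by exact_mod_cast Fintype.one_lt_card
  have hP := one_lt_pow₀ hq (show k ≠ 0 by omega)
  have hPQ := pow_le_pow_right₀ hq.le hkn
  rw [hitProb, finrank_sym, div_le_div_iff₀ (by linarith) (by linarith)]
  nlinarith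

theorem le_hitProb (hk : 1 ≤ k) (hkn : k ≤ (n + 1).choose 2) :
    (Fintype.card F : ℝ) ^ k / (Fintype.card F : ℝ) ^ (n + 1).choose 2 ≤
      2 * hitProb F (Sym F n) k := by
  have hq : (2 : ℝ) ≤ Fintype.card F := by exact_mod_cast Fintype.one_lt_card (α := F)
  have hP := le_self_pow₀ (by linarith : (1 : ℝ) ≤ Fintype.card F) (show k ≠ 0 by omega)
  have hPQ := pow_le_pow_right₀ (by linarith : (1 : ℝ) ≤ Fintype.card F) hkn
  rw [hitProb, finrank_sym, ← mul_div_assoc, div_le_div_iff₀ (by linarith) (by linarith)]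
  nlinarith

theorem symDensity_le_one (n k d : ℕ) : symDensity F n k d ≤ 1 := by
  refine div_le_one_of_le₀ (Nat.cast_le.2 (Set.ncard_le_ncard (Set.sep_subset _ _) ?_))
    (Nat.cast_nonneg _)
  exact Set.toFinite _

open Classical in
/-- Quantitative upper bound for the density. -/
theorem symDensity_le (hn : 2 ≤ n) (hr : 1 ≤ r) (hrn : r ≤ n) (hk : 1 ≤ k)
    (hkn : k ≤ (n + 1).choose 2) :
    symDensity F n k (r + 1) ≤ 2 ^ (r + 2) * ((Fintype.card F : ℝ) ^ ((n + 1).choose 2 + 1) /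
      (Fintype.card F : ℝ) ^ (k + rankDim n r)) := by
  have hkV : k ≤ Module.finrank F (Sym F n) := by rwa [finrank_sym]
  have hT : (0 : ℝ) < (subspaces F (Sym F n) k).card := by exact_mod_cast card_subspaces_pos hkV
  have h := card_avoiding_mul_le hk hkV _ (zero_notMem_lowRank (F := F) n (r + 1))
  have hq : (1 : ℝ) < Fintype.card F := by exact_mod_cast Fintype.one_lt_card
  have hB : (Fintype.card F : ℝ) ^ rankDim n r ≤ 2 ^ (r + 1) * (lowRank F n (r + 1)).card := by
    exact_mod_cast pow_rankDim_le_card_lowRank hn hr hrn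
  have hp := le_hitProb (F := F) hk hkn
  have hδ : symDensity F n k (r + 1) * ((lowRank F n (r + 1)).card * hitProb F (Sym F n) k) ≤
      Fintype.card F := by
    rw [symDensity_eq hk, div_mul_eq_mul_div, div_le_iff₀ hT]
    nlinarith
  have hδ0 : 0 ≤ symDensity F n k (r + 1) := div_nonneg (Nat.cast_nonneg _) (Nat.cast_nonneg _)
  -- The constant combines 2^(r+1) from the count of low-rank matrices with 2 from `le_hitProb`.
  have hμ : (Fintype.card F : ℝ) ^ rankDim n r *
      ((Fintype.card F : ℝ) ^ k / (Fintype.card F : ℝ) ^ (n + 1).choose 2) ≤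
      2 ^ (r + 2) * ((lowRank F n (r + 1)).card * hitProb F (Sym F n) k) := by
    calc _ ≤ (2 ^ (r + 1) * ((lowRank F n (r + 1)).card : ℝ)) *
          (2 * hitProb F (Sym F n) k) := by gcongr
      _ = _ := by ring
  have hq0 : (0 : ℝ) < Fintype.card F := by linarith
  have hfin : symDensity F n k (r + 1) * ((Fintype.card F : ℝ) ^ rankDim n r *
      ((Fintype.card F : ℝ) ^ k / (Fintype.card F : ℝ) ^ (n + 1).choose 2)) ≤
      2 ^ (r + 2) * Fintype.card F := by
    calc _ ≤ symDensity F n k (r + 1) *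
          (2 ^ (r + 2) * ((lowRank F n (r + 1)).card * hitProb F (Sym F n) k)) := by gcongr
      _ = 2 ^ (r + 2) * (symDensity F n k (r + 1) *
          ((lowRank F n (r + 1)).card * hitProb F (Sym F n) k)) := by ring
      _ ≤ _ := by gcongr
  rw [← mul_div_assoc, ← mul_div_assoc, div_le_iff₀ (by positivity)] at hfin
  rw [← mul_div_assoc, le_div_iff₀ (by positivity)]
  calc _ = symDensity F n k (r + 1) * ((Fintype.card F : ℝ) ^ rankDim n r *
        (Fintype.card F : ℝ) ^ k) := by ring
    _ ≤ _ := hfin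
    _ = _ := by ring

open Classical in
/-- Quantitative lower bound for the density. -/
theorem one_sub_symDensity_le (hrn : r ≤ n) (hk : 1 ≤ k) (hkn : k ≤ (n + 1).choose 2) :
    1 - symDensity F n k (r + 1) ≤ 2 * n.choose r * ((Fintype.card F : ℝ) ^ (k + rankDim n r) /
      (Fintype.card F : ℝ) ^ ((n + 1).choose 2 + 1)) := by
  have hkV : k ≤ Module.finrank F (Sym F n) := by rwa [finrank_sym]
  have hT : (0 : ℝ) < (subspaces F (Sym F n) k).card := by exact_mod_cast card_subspaces_pos hkV
  have h := card_meeting_mul_le k _ (zero_notMem_lowRank (F := F) n (r + 1))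
    fun a M hM => smul_mem_lowRank a hM
  have hq : (2 : ℝ) ≤ Fintype.card F := by exact_mod_cast Fintype.one_lt_card (α := F)
  have hq0 : (0 : ℝ) < Fintype.card F := by linarith
  have hB : ((lowRank F n (r + 1)).card : ℝ) ≤ n.choose r * (Fintype.card F : ℝ) ^ rankDim n r := by
    have h1 := card_lowRank_add_one (F := F) n r
    have h2 := ncard_symRankLE_le (F := F) n r hrn
    exact_mod_cast (by omega : (lowRank F n (r + 1)).card ≤ n.choose r * Fintype.card F ^ rankDim n r)
  have hp := hitProb_le (F := F) hk hkn
  have hp0 := (hitProb_pos (K := F) hk hkV).le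
  have hsplit := Finset.card_filter_add_card_filter_not (s := subspaces F (Sym F n) k)
    (fun C => Avoids (lowRank F n (r + 1)) C)
  have hδ : 1 - symDensity F n k (r + 1) = (((subspaces F (Sym F n) k).filter
      fun C => ¬ Avoids (lowRank F n (r + 1)) C).card : ℝ) /
        (subspaces F (Sym F n) k).card := by
    rw [symDensity_eq hk, eq_div_iff hT.ne', sub_mul, div_mul_cancel₀ _ hT.ne', one_mul,
      ← hsplit]
    push_cast
    ring
  have h1 : (1 - symDensity F n k (r + 1)) * (Fintype.card F - 1) ≤
      (lowRank F n (r + 1)).card * hitProb F (Sym F n) k := by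
    rw [hδ, div_mul_eq_mul_div, div_le_iff₀ hT]
    linarith
  have h2 : ((lowRank F n (r + 1)).card : ℝ) * hitProb F (Sym F n) k ≤
      n.choose r * (Fintype.card F : ℝ) ^ rankDim n r *
        ((Fintype.card F : ℝ) ^ k / (Fintype.card F : ℝ) ^ (n + 1).choose 2) := by gcongr
  -- Uses q ≤ 2(q-1) together with 1 - δ ≥ 0.
  have h3 : (1 - symDensity F n k (r + 1)) * Fintype.card F ≤
      2 * (n.choose r * (Fintype.card F : ℝ) ^ rankDim n r *
        ((Fintype.card F : ℝ) ^ k / (Fintype.card F : ℝ) ^ (n + 1).choose 2)) := by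
    have := sub_nonneg.2 (symDensity_le_one (F := F) n k (r + 1))
    nlinarith
  rw [← le_div_iff₀ hq0] at h3
  refine h3.trans (le_of_eq ?_)
  rw [pow_add, pow_succ]
  field_simp

end Density

/-! ### Real exponents and the limit over prime powers -/

theorem cast_rankDim {n r : ℕ} (hr : r ≤ n) :
    (rankDim n r : ℝ) = n * r - r * (r - 1) / 2 := by
  have h : (n - r + 1).choose 2 ≤ (n + 1).choose 2 := Nat.choose_le_choose 2 (by omega)
  rw [rankDim, Nat.cast_sub h, Nat.cast_choose_two, Nat.cast_choose_two]
  push_cast [Nat.cast_sub hr]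
  ring

theorem cast_choose_two_succ (n : ℕ) : (((n + 1).choose 2 : ℕ) : ℝ) = n * (n + 1) / 2 := by
  rw [Nat.cast_choose_two]
  push_cast
  ring

theorem tendsto_primePower_cast :
    Tendsto (fun q : PrimePower => ((q : ℕ) : ℝ)) atTop atTop := by
  refine tendsto_natCast_atTop_atTop.comp
    (tendsto_atTop_atTop_of_monotone (fun _ _ h => h) fun b => ?_)
  obtain ⟨p, hbp, hp⟩ := Nat.exists_infinite_primes b
  exact ⟨⟨p, hp.isPrimePow⟩, hbp⟩

theorem tendsto_primePower_rpow {e : ℝ} (he : e < 0) :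
    Tendsto (fun q : PrimePower => ((q : ℕ) : ℝ) ^ e) atTop (𝓝 0) := by
  have := (tendsto_rpow_neg_atTop (neg_pos.2 he)).comp tendsto_primePower_cast
  simpa [Function.comp_def] using this

/-- The exponent governing the density. -/
theorem pow_div_pow_eq_rpow {q : ℝ} (hq : 0 < q) {n k d : ℕ} (hd : 1 ≤ d) (hdn : d ≤ n + 1) :
    q ^ ((n + 1).choose 2 + 1) / q ^ (k + rankDim n (d - 1)) =
      q ^ ((n : ℝ) * ((n : ℝ) + 1) / 2 - k + 1 - n * ((d : ℝ) - 1)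
        + ((d : ℝ) - 1) * ((d : ℝ) - 2) / 2) := by
  rw [← Real.rpow_natCast, ← Real.rpow_natCast, ← Real.rpow_sub hq]
  congr 1
  rw [Nat.cast_add, Nat.cast_add, cast_choose_two_succ, cast_rankDim (by omega)]
  push_cast [Nat.cast_sub hd]
  ring

theorem pow_div_pow_eq_rpow_neg {q : ℝ} (hq : 0 < q) {n k d : ℕ} (hd : 1 ≤ d) (hdn : d ≤ n + 1) :
    q ^ (k + rankDim n (d - 1)) / q ^ ((n + 1).choose 2 + 1) =
      q ^ (-((n : ℝ) * ((n : ℝ) + 1) / 2 - k + 1 - n * ((d : ℝ) - 1)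
        + ((d : ℝ) - 1) * ((d : ℝ) - 2) / 2)) := by
  rw [Real.rpow_neg hq.le, ← pow_div_pow_eq_rpow hq hd hdn, inv_div]

theorem symDensity_nonneg (F : Type*) [Field F] (n k d : ℕ) : 0 ≤ symDensity F n k d :=
  div_nonneg (Nat.cast_nonneg _) (Nat.cast_nonneg _)

variable (F : PrimePower → Type*) [∀ q, Field (F q)]

theorem symDensity_le_rpow (hF : ∀ q : PrimePower, Nat.card (F q) = (q : ℕ)) {n k d : ℕ}
    (hd : 2 ≤ d) (hdn : d ≤ n) (hk : 1 ≤ k) (hkn : k ≤ (n + 1).choose 2) (q : PrimePower) :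
    symDensity (F q) n k d ≤ 2 ^ (d + 1) * ((q : ℕ) : ℝ) ^
      ((n : ℝ) * ((n : ℝ) + 1) / 2 - k + 1 - n * ((d : ℝ) - 1)
        + ((d : ℝ) - 1) * ((d : ℝ) - 2) / 2) := by
  have hq : 0 < (q : ℕ) := q.2.pos
  have := Nat.finite_of_card_ne_zero (hF q ▸ hq.ne')
  have := Fintype.ofFinite (F q)
  have h := symDensity_le (F := F q) (r := d - 1) (by omega : 2 ≤ n) (by omega) (by omega) hk hkn
  rw [← Nat.card_eq_fintype_card, hF q, pow_div_pow_eq_rpow (by exact_mod_cast hq) (by omega)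
    (by omega), show d - 1 + 1 = d by omega, show d - 1 + 2 = d + 1 by omega] at h
  exact h

theorem one_sub_symDensity_le_rpow (hF : ∀ q : PrimePower, Nat.card (F q) = (q : ℕ)) {n k d : ℕ}
    (hd : 2 ≤ d) (hdn : d ≤ n) (hk : 1 ≤ k) (hkn : k ≤ (n + 1).choose 2) (q : PrimePower) :
    symDensity (F q) n k d ≤ 1 ∧
    1 - symDensity (F q) n k d ≤ 2 * n.choose (d - 1) * ((q : ℕ) : ℝ) ^
      (-((n : ℝ) * ((n : ℝ) + 1) / 2 - k + 1 - n * ((d : ℝ) - 1)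
        + ((d : ℝ) - 1) * ((d : ℝ) - 2) / 2)) := by
  have hq : 0 < (q : ℕ) := q.2.pos
  have := Nat.finite_of_card_ne_zero (hF q ▸ hq.ne')
  have := Fintype.ofFinite (F q)
  have h := one_sub_symDensity_le (F := F q) (r := d - 1) (by omega : d - 1 ≤ n) hk hkn
  rw [← Nat.card_eq_fintype_card, hF q, pow_div_pow_eq_rpow_neg (by exact_mod_cast hq) (by omega)
    (by omega), show d - 1 + 1 = d by omega] at h
  exact ⟨symDensity_le_one n k d, h⟩

theorem symDensity_isBigO (hF : ∀ q : PrimePower, Nat.card (F q) = (q : ℕ)) {n k d : ℕ}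
    (hd : 2 ≤ d) (hdn : d ≤ n) (hk : 1 ≤ k) (hkn : k ≤ (n + 1).choose 2) :
    (fun q : PrimePower => symDensity (F q) n k d) =O[atTop]
      (fun q : PrimePower => ((q : ℕ) : ℝ) ^
        ((n : ℝ) * ((n : ℝ) + 1) / 2 - k + 1 - n * ((d : ℝ) - 1)
          + ((d : ℝ) - 1) * ((d : ℝ) - 2) / 2)) := by
  refine IsBigO.of_bound (2 ^ (d + 1)) (Eventually.of_forall fun q => ?_)
  rw [Real.norm_of_nonneg (symDensity_nonneg _ _ _ _),
    Real.norm_of_nonneg (Real.rpow_nonneg (Nat.cast_nonneg _) _)]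
  exact symDensity_le_rpow F hF hd hdn hk hkn q

end SymRankMetric


theorem theorem6p7
    (F : SymRankMetric.PrimePower → Type*) [∀ q, Field (F q)]
    (hF : ∀ q : SymRankMetric.PrimePower, Nat.card (F q) = (q : ℕ))
    (n : ℕ) (hn : 2 ≤ n) :
    (∀ k d : ℕ, 2 ≤ d → d ≤ n → 1 ≤ k →
      (k : ℝ) ≤ (if Even (n - d) then (n : ℝ) * ((n : ℝ) - d + 2) / 2
        else ((n : ℝ) + 1) * ((n : ℝ) - d + 1) / 2) →
      ((fun q : SymRankMetric.PrimePower => SymRankMetric.symDensity (F q) n k d) =O[atTop]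
          (fun q : SymRankMetric.PrimePower => ((q : ℕ) : ℝ) ^
            ((n : ℝ) * ((n : ℝ) + 1) / 2 - k + 1 - n * ((d : ℝ) - 1)
              + ((d : ℝ) - 1) * ((d : ℝ) - 2) / 2))) ∧
      ((k : ℝ) < (n : ℝ) * ((n : ℝ) + 1) / 2 + 1 - n * ((d : ℝ) - 1)
            + ((d : ℝ) - 1) * ((d : ℝ) - 2) / 2 →
        Tendsto (fun q : SymRankMetric.PrimePower => SymRankMetric.symDensity (F q) n k d)
          atTop (𝓝 1)) ∧
      ((n : ℝ) * ((n : ℝ) + 1) / 2 + 1 - n * ((d : ℝ) - 1)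
            + ((d : ℝ) - 1) * ((d : ℝ) - 2) / 2 < (k : ℝ) →
        Tendsto (fun q : SymRankMetric.PrimePower => SymRankMetric.symDensity (F q) n k d)
          atTop (𝓝 0))) ∧
    ((fun q : SymRankMetric.PrimePower => SymRankMetric.symDensity (F q) n n n) =O[atTop]
        (fun q : SymRankMetric.PrimePower => ((q : ℕ) : ℝ) ^ (-(n : ℝ) + 2))) := by
  refine ⟨fun k d hd hdn hk hkb => ?_, ?_⟩
  · have hkn : k ≤ (n + 1).choose 2 := by
      have h2d : (2 : ℝ) ≤ d := by exact_mod_cast hd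
      have h2n : (2 : ℝ) ≤ n := by exact_mod_cast hn
      rw [← Nat.cast_le (α := ℝ), SymRankMetric.cast_choose_two_succ]
      -- As d ≥ 2, the two bounds on k are at most n²/2 and (n+1)(n-1)/2, both below dim Sym_n.
      split_ifs at hkb <;> nlinarith
    refine ⟨SymRankMetric.symDensity_isBigO F hF hd hdn hk hkn, fun hlt => ?_, fun hgt => ?_⟩
    · have hlim := ((SymRankMetric.tendsto_primePower_rpow (neg_lt_zero.2
        (by linarith : (0 : ℝ) < (n : ℝ) * ((n : ℝ) + 1) / 2 - k + 1 - n * ((d : ℝ) - 1)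
          + ((d : ℝ) - 1) * ((d : ℝ) - 2) / 2))).const_mul
            (2 * (n.choose (d - 1) : ℝ))).const_sub 1
      rw [mul_zero, sub_zero] at hlim
      refine tendsto_of_tendsto_of_tendsto_of_le_of_le hlim tendsto_const_nhds (fun q => ?_)
        fun q => (SymRankMetric.one_sub_symDensity_le_rpow F hF hd hdn hk hkn q).1
      have := (SymRankMetric.one_sub_symDensity_le_rpow F hF hd hdn hk hkn q).2
      exact sub_le_comm.1 this
    · exact (SymRankMetric.symDensity_isBigO F hF hd hdn hk hkn).trans_tendsto
        (SymRankMetric.tendsto_primePower_rpow (by linarith))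
  · have hkn : n ≤ (n + 1).choose 2 := by
      rw [Nat.choose_succ_succ' n 1, Nat.choose_one_right]
      omega
    have h := SymRankMetric.symDensity_isBigO F hF hn le_rfl (by omega) hkn
    have he : (n : ℝ) * ((n : ℝ) + 1) / 2 - n + 1 - n * ((n : ℝ) - 1)
        + ((n : ℝ) - 1) * ((n : ℝ) - 2) / 2 = -(n : ℝ) + 2 := by ring
    rwa [he] at h
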